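/- **Theorem 1 (v-GNE seeking).** Consider $N$ static agents. Agent $i\in\{1,\dots,N\}$ chooses $u_i\in\Omega_i\subseteq\mathbb R^{m_i}$, and $u=\operatorname{col}(u_1,\dots,u_N)\in\mathbb R^m$, $m=\sum_i m_i$. The decisions are coupled by $Au=\sum_i A_iu_i\le b$ with $A=[A_1\ \cdots\ A_N]\in\mathbb R^{q\times m}$, $b\in\mathbb R^q$, and $\mathcal U=(\Omega_1\times\dots\times\Omega_N)\cap\{u: Au\le b\}$ is the overall feasible set. Agent $i$ has the cost $J_i:\mathbb R^m\to\mathbb R$, and $F(u)=\operatorname{col}\big((\nabla_{u_i}J_i(u_i,u_{-i}))_{i}\big)$ is the pseudo-gradient. Assume: - every $\Omega_i$ is nonempty, closed and convex, and Slater's condition holds: there is $u\in\Omega_1\times\dots\times\Omega_N$ with $Au<b$ componentwise; - for every $i$, $J_i(\cdot,u_{-i})$ is convex for every $u_{-i}$, $J_i$ is twice differentiable, and $\nabla J_i$ is $\ell$-Lipschitz continuous on $\mathbb R^m$, with $\ell>0$; - $F$ is $\mu$-strongly monotone with $\mu>0$: $(u-v)^\top(F(u)-F(v))\ge\mu\|u-v\|^2$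 for all $u,v\in\mathbb R^m$. A generalized Nash equilibrium (GNE) is a point $u^*\in\mathcal U$ such that, for every $i$, $J_i(u^*)\le J_i(v_i,u^*_{-i})$ for all $v_i\in\Omega_i$ with $(v_i,u^*_{-i})\in\mathcal U$. It is variational (a v-GNE) if moreover $F(u^*)^\top(v-u^*)\ge0$ for all $v\in\mathcal U$. Then the game has exactly one v-GNE $u^*$, and there is $\bar\gamma>0$ such that for all step sizes $\gamma_0,\gamma_1,\dots,\gamma_N\in(0,\bar\gamma]$ and every solution $(u(t),\lambda(t))_{t\ge0}$ in $\mathbb R^m\times\mathbb R^q$ (from an arbitrary initial condition) of the projected primal–dual dynamics $$\dot u_i=-u_i+\operatorname{proj}_{\Omega_i}\!\big(u_i-\gamma_i(\nabla_{u_i}J_i(u)+A_i^\top\lambda)\big),\quad i=1,\dots,N,$$ $$\dot\lambda=-\lambda+\operatorname{proj}_{\ge0}\!\big(\lambda+\gamma_0(Au-b+2A\dot u)\big),$$ the pair $(u(t),\lambda(t))$ converges, as $t\to\infty$, to $(u^*,\lambda^*)$ for some $\lambda^*\in\mathbb R^q_{\ge0}$. -/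

import Mathlib

open Filter Topology

noncomputable section

/-- The Euclidean space `ℝᵏ`. -/
abbrev EucVec (k : ℕ) : Type := EuclideanSpace ℝ (Fin k)

/-- The space `ℝ^{m₁} × ⋯ × ℝ^{m_N}` of collective decisions `u = col(u₁, …, u_N)`, with the
Euclidean inner product and norm. -/
abbrev JointVec {N : ℕ} (m : Fin N → ℕ) : Type := PiLp 2 (fun i => EucVec (m i))

/-- The collective vector `(v, u_{-i})`: the `i`-th block of `u` is replaced by `v`. -/
def withBlock {N : ℕ} {m : Fin N → ℕ} (u : JointVec m) (i : Fin N) (v : EucVec (m i)) :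
    JointVec m :=
  WithLp.toLp 2 (Function.update (fun j => u j) i v)

/-- The projection `proj_S v = argmin_{y ∈ S} ‖y - v‖` onto `S` (only used for nonempty closed
convex sets in a Euclidean space, where the minimizer exists and is unique). -/
def proj {E : Type*} [NormedAddCommGroup E] (S : Set E) (v : E) : E :=
  Classical.epsilon fun y => y ∈ S ∧ ∀ z ∈ S, ‖y - v‖ ≤ ‖z - v‖

/-- The nonnegative orthant of `ℝ^q`. -/
def nonnegOrthant (q : ℕ) : Set (EucVec q) := {v | ∀ j, 0 ≤ v j}

/-- The data of a game with `N` agents, agent `i` choosing `u_i ∈ Ω i ⊆ ℝ^{m i}` so as to minimize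
the cost `J i`, subject to `q` affine coupling constraints `∑ i, A i * u_i ≤ b`
(`A i` is the block of columns of the constraint matrix that belongs to agent `i`). -/
structure GNEGame (N : ℕ) (m : Fin N → ℕ) (q : ℕ) where
  /-- local constraint sets -/
  Ω : (i : Fin N) → Set (EucVec (m i))
  /-- blocks of the coupling constraint matrix -/
  A : (i : Fin N) → Matrix (Fin q) (Fin (m i)) ℝ
  /-- right-hand side of the coupling constraints -/
  b : EucVec q
  /-- cost functions -/
  J : Fin N → JointVec m → ℝ

namespace GNEGame

variable {N : ℕ} {m : Fin N → ℕ} {q : ℕ} (G : GNEGame N m q)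

/-- `A u`, for the full constraint matrix `A = [A₁ ⋯ A_N]`. -/
def mulA (u : JointVec m) : EucVec q :=
  WithLp.toLp 2 (∑ i, (G.A i).mulVec (fun k => u i k))

/-- `A_iᵀ l`. -/
def mulAT (i : Fin N) (l : EucVec q) : EucVec (m i) :=
  WithLp.toLp 2 ((G.A i).transpose.mulVec (fun j => l j))

/-- The overall feasible set `U = (Ω₁ × ⋯ × Ω_N) ∩ {u | A u ≤ b}`. -/
def feasible : Set (JointVec m) :=
  {u | (∀ i, u i ∈ G.Ω i) ∧ ∀ j, G.mulA u j ≤ G.b j}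

/-- The partial gradient `∇_{u_i} J_i (u_i, u_{-i})`. -/
def partialGrad (i : Fin N) (u : JointVec m) : EucVec (m i) :=
  gradient (fun v : EucVec (m i) => G.J i (withBlock u i v)) (u i)

/-- The pseudo-gradient `F u = col(∇_{u_i} J_i (u_i, u_{-i}))`. -/
def pseudoGrad (u : JointVec m) : JointVec m :=
  WithLp.toLp 2 (fun i => G.partialGrad i u)

/-- Generalized Nash equilibria. -/
def IsGNE (u : JointVec m) : Prop :=
  u ∈ G.feasible ∧
    ∀ i, ∀ v ∈ G.Ω i, withBlock u i v ∈ G.feasible → G.J i u ≤ G.J i (withBlock u i v)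

/-- Variational generalized Nash equilibria: the generalized Nash equilibria that solve the
variational inequality of the pseudo-gradient over the overall feasible set. -/
def IsVariationalGNE (u : JointVec m) : Prop :=
  G.IsGNE u ∧ ∀ v ∈ G.feasible, 0 ≤ inner ℝ (G.pseudoGrad u) (v - u)

/-- The standing assumptions, with Lipschitz constant `ℓ` of the gradients and constant `μ` of
strong monotonicity. -/
structure StandingAssumptions (ℓ μ : ℝ) : Prop where
  ℓ_pos : 0 < ℓ
  μ_pos : 0 < μ
  Ω_nonempty : ∀ i, (G.Ω i).Nonempty
  Ω_closed : ∀ i, IsClosed (G.Ω i)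
  Ω_convex : ∀ i, Convex ℝ (G.Ω i)
  /-- Slater's constraint qualification (in particular, the feasible set is nonempty) -/
  slater : ∃ u : JointVec m, (∀ i, u i ∈ G.Ω i) ∧ ∀ j, G.mulA u j < G.b j
  J_convex : ∀ i, ∀ u : JointVec m,
    ConvexOn ℝ Set.univ (fun v : EucVec (m i) => G.J i (withBlock u i v))
  /-- the costs are twice differentiable -/
  J_differentiable : ∀ i, Differentiable ℝ (G.J i)
  grad_differentiable : ∀ i, Differentiable ℝ (gradient (G.J i))
  grad_lipschitz : ∀ i, ∀ u v : JointVec m,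
    ‖gradient (G.J i) u - gradient (G.J i) v‖ ≤ ℓ * ‖u - v‖
  strongly_monotone : ∀ u v : JointVec m,
    μ * ‖u - v‖ ^ 2 ≤ inner ℝ (u - v) (G.pseudoGrad u - G.pseudoGrad v)

/-- `(u(t), l(t))_{t ≥ 0}` is a (classical) solution of the projected primal-dual dynamics
`u_i' = -u_i + proj_{Ω_i}(u_i - γ_i (∇_{u_i} J_i(u) + A_iᵀ l))`,
`l' = -l + proj_{≥ 0}(l + γ₀ (A u - b + 2 A u'))`
with step sizes `γ_i` and `γ₀`; the derivative at time `0` is one-sided. -/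
def IsSolution (γ : Fin N → ℝ) (γ₀ : ℝ) (u : ℝ → JointVec m) (l : ℝ → EucVec q) : Prop :=
  ∀ t : ℝ, 0 ≤ t → ∃ (du : JointVec m) (dl : EucVec q),
    HasDerivWithinAt u du (Set.Ici 0) t ∧
    HasDerivWithinAt l dl (Set.Ici 0) t ∧
    (∀ i, du i = -(u t i) +
      proj (G.Ω i) (u t i - γ i • (G.partialGrad i (u t) + G.mulAT i (l t)))) ∧
    dl = -(l t) +
      proj (nonnegOrthant q) (l t + γ₀ • (G.mulA (u t) - G.b + (2 : ℝ) • G.mulA du))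

end GNEGame

end

/-! Existence and uniqueness of the v-GNE come from the variational inequality of `pseudoGrad` over
the feasible set. Its solution is a fixed point of a projected gradient contraction, and convexity
of each cost in the own variable makes it a GNE (`isVariationalGNE`). Slater's condition supplies a
multiplier (`exists_isKKTPair`).

For convergence, put z = (u, λ) and D = diag(1/γ_i). The obtuse-angle property of projections turns
the dynamics into 0 ∈ P ż + (F(u), b) + T(z + ż), where T is the sum of the skew coupling and the
normal cones and P = [[D, -Aᵀ], [-A, 1/γ₀]]; the term 2A u̇ is what makes P symmetric. Let V(z) = |z
- z*|²_P for a KKT pair z*. The skew part of T cancels, strong monotonicity absorbs the error of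
evaluating F at u instead of u + u̇, and small steps make P large enough for V' ≤ -2|ż|²
(`IsPrimalDualStep.lyapunov_le`).

So V is nonincreasing and trajectories are bounded. Along some times ż → 0, and a cluster point p is
a KKT pair. Using p itself as the centre of V, monotonicity upgrades subsequential convergence to
convergence (`exists_isKKTPair_tendsto`). The multiplier need not be unique, but the primal part of
p is u*. -/

noncomputable section

/-! ### Projections and strongly monotone variational inequalities -/

section Projection

variable {E : Type*} [NormedAddCommGroup E] [InnerProductSpace ℝ E]

/-- Completeness provides a minimizer, so the choice in `proj` is a genuine one; everything later
uses `proj` only through this obtuse-angle property. -/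
theorem proj_mem_and_inner_le_zero [CompleteSpace E] {S : Set E} (hne : S.Nonempty)
    (hcl : IsClosed S) (hcv : Convex ℝ S) (v : E) :
    proj S v ∈ S ∧ ∀ w ∈ S, inner ℝ (v - proj S v) (w - proj S v) ≤ 0 := by
  obtain ⟨y, hy, hmin⟩ := exists_norm_eq_iInf_of_complete_convex hne hcl.isComplete hcv v
  have hbdd : BddBelow (Set.range fun w : S => ‖v - w‖) :=
    ⟨0, by rintro _ ⟨w, rfl⟩; exact norm_nonneg _⟩
  have hex : ∃ y, y ∈ S ∧ ∀ z ∈ S, ‖y - v‖ ≤ ‖z - v‖ := by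
    refine ⟨y, hy, fun z hz => ?_⟩
    rw [norm_sub_rev y, norm_sub_rev z, hmin]
    exact ciInf_le hbdd ⟨z, hz⟩
  obtain ⟨hmem, hle⟩ : proj S v ∈ S ∧ ∀ z ∈ S, ‖proj S v - v‖ ≤ ‖z - v‖ :=
    Classical.epsilon_spec hex
  refine ⟨hmem, (norm_eq_iInf_iff_real_inner_le_zero hcv hmem).1 (le_antisymm ?_ ?_)⟩
  · have : Nonempty S := ⟨⟨y, hy⟩⟩
    refine le_ciInf fun w => ?_
    rw [norm_sub_rev v, norm_sub_rev v]
    exact hle w w.2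
  · exact ciInf_le hbdd ⟨_, hmem⟩

/-- Adding the two obtuse-angle inequalities gives firm nonexpansiveness; Cauchy–Schwarz finishes.
-/
theorem norm_proj_sub_proj_le [CompleteSpace E] {S : Set E} (hne : S.Nonempty)
    (hcl : IsClosed S) (hcv : Convex ℝ S) (v w : E) : ‖proj S v - proj S w‖ ≤ ‖v - w‖ := by
  obtain ⟨hv, hv'⟩ := proj_mem_and_inner_le_zero hne hcl hcv v
  obtain ⟨hw, hw'⟩ := proj_mem_and_inner_le_zero hne hcl hcv w
  set p := proj S v
  set r := proj S w
  have h : ‖p - r‖ ^ 2 ≤ inner ℝ (v - w) (p - r) := by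
    have h1 := hv' r hw
    have h2 := hw' p hv
    have h3 : inner ℝ (v - p) (r - p) + inner ℝ (w - r) (p - r)
        = ‖p - r‖ ^ 2 - inner ℝ (v - w) (p - r) := by
      rw [← real_inner_self_eq_norm_sq]
      simp only [inner_sub_left, inner_sub_right]
      ring
    linarith
  have h' := real_inner_le_norm (v - w) (p - r)
  by_contra! hlt
  nlinarith [norm_nonneg (v - w), norm_nonneg (p - r)]

/-- A strongly monotone Lipschitz variational inequality over a closed convex set is solvable. -/
theorem exists_variationalInequality_solution [CompleteSpace E] {S : Set E} (hne : S.Nonempty)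
    (hcl : IsClosed S) (hcv : Convex ℝ S) {F : E → E} {L μ : ℝ} (hμ : 0 < μ)
    (hL : ∀ u v, ‖F u - F v‖ ≤ L * ‖u - v‖)
    (hF : ∀ u v, μ * ‖u - v‖ ^ 2 ≤ inner ℝ (u - v) (F u - F v)) :
    ∃ u ∈ S, ∀ v ∈ S, 0 ≤ inner ℝ (F u) (v - u) := by
  -- Enlarging the Lipschitz constant beyond μ keeps 1 - μ²/M² nonnegative. The step τ = μ/M² below
  -- minimizes 1 - 2τμ + τ²M², with that minimum.
  obtain ⟨M, hLM, hμM⟩ : ∃ M, L ≤ M ∧ μ < M := ⟨max L μ + 1, by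
    linarith [le_max_left L μ], by linarith [le_max_right L μ]⟩
  have hM : 0 < M := hμ.trans hμM
  have hLip : ∀ u v, ‖F u - F v‖ ≤ M * ‖u - v‖ := fun u v =>
    (hL u v).trans (mul_le_mul_of_nonneg_right hLM (norm_nonneg _))
  set τ : ℝ := μ / M ^ 2 with hτdef
  have hτ : 0 < τ := by positivity
  have hq : 0 ≤ 1 - μ ^ 2 / M ^ 2 := by
    rw [sub_nonneg, div_le_one (by positivity)]
    exact pow_le_pow_left₀ hμ.le hμM.le 2
  have hq1 : √(1 - μ ^ 2 / M ^ 2) < 1 := by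
    rw [Real.sqrt_lt' one_pos]
    have : 0 < μ ^ 2 / M ^ 2 := by positivity
    linarith
  let k : NNReal := ⟨√(1 - μ ^ 2 / M ^ 2), Real.sqrt_nonneg _⟩
  have hT : ContractingWith k fun u => proj S (u - τ • F u) := by
    refine ⟨by exact_mod_cast hq1, LipschitzWith.of_dist_le_mul fun u v => ?_⟩
    rw [dist_eq_norm, dist_eq_norm]
    refine (norm_proj_sub_proj_le hne hcl hcv _ _).trans ?_
    have hsq : ‖u - τ • F u - (v - τ • F v)‖ ^ 2 ≤ (1 - μ ^ 2 / M ^ 2) * ‖u - v‖ ^ 2 := by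
      have e : u - τ • F u - (v - τ • F v) = (u - v) - τ • (F u - F v) := by
        rw [smul_sub]; abel
      rw [e, norm_sub_sq_real, inner_smul_right, norm_smul, mul_pow, Real.norm_eq_abs, sq_abs]
      have h1 := hF u v
      have h2 : ‖F u - F v‖ ^ 2 ≤ M ^ 2 * ‖u - v‖ ^ 2 := by
        rw [← mul_pow]
        exact pow_le_pow_left₀ (norm_nonneg _) (hLip u v) 2
      have h3 := mul_le_mul_of_nonneg_left h1 hτ.le
      have h4 := mul_le_mul_of_nonneg_left h2 (sq_nonneg τ)
      have h5 : τ * (μ * ‖u - v‖ ^ 2) = μ ^ 2 / M ^ 2 * ‖u - v‖ ^ 2 := by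
        rw [hτdef]; ring
      have h6 : τ ^ 2 * (M ^ 2 * ‖u - v‖ ^ 2) = μ ^ 2 / M ^ 2 * ‖u - v‖ ^ 2 := by
        rw [hτdef]; field_simp
      linarith
    have hk : (k : ℝ) * ‖u - v‖ = √((1 - μ ^ 2 / M ^ 2) * ‖u - v‖ ^ 2) := by
      rw [Real.sqrt_mul hq, Real.sqrt_sq (norm_nonneg _)]; rfl
    rw [hk]
    exact Real.le_sqrt_of_sq_le hsq
  have : Nonempty E := ⟨0⟩
  have hfix : proj S (_ - τ • F _) = ContractingWith.fixedPoint _ hT :=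
    hT.fixedPoint_isFixedPt
  set u := ContractingWith.fixedPoint _ hT
  obtain ⟨hmem, hvi⟩ := proj_mem_and_inner_le_zero hne hcl hcv (u - τ • F u)
  rw [hfix] at hmem hvi
  refine ⟨u, hmem, fun v hv => ?_⟩
  have h := hvi v hv
  rw [sub_sub_cancel_left, inner_neg_left, real_inner_smul_left] at h
  by_contra! hlt
  nlinarith

theorem variationalInequality_unique {S : Set E} {F : E → E} {μ : ℝ} (hμ : 0 < μ)
    (hF : ∀ u v, μ * ‖u - v‖ ^ 2 ≤ inner ℝ (u - v) (F u - F v)) {u v : E}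
    (hu : u ∈ S) (hu' : ∀ w ∈ S, 0 ≤ inner ℝ (F u) (w - u))
    (hv : v ∈ S) (hv' : ∀ w ∈ S, 0 ≤ inner ℝ (F v) (w - v)) : u = v := by
  have h1 := hu' v hv
  have h2 := hv' u hu
  have h3 := hF u v
  have h4 : inner ℝ (u - v) (F u - F v) = -(inner ℝ (F u) (v - u) + inner ℝ (F v) (u - v)) := by
    rw [real_inner_comm]
    simp only [inner_sub_left, inner_sub_right]
    ring
  have h5 : ‖u - v‖ ^ 2 ≤ 0 := by
    by_contra! h
    nlinarith
  have h6 : ‖u - v‖ = 0 := by nlinarith [norm_nonneg (u - v)]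
  exact sub_eq_zero.1 (norm_eq_zero.1 h6)

end Projection

/-- A differentiable convex function lies above its tangents. -/
theorem ConvexOn.add_inner_gradient_le {E : Type*} [NormedAddCommGroup E] [InnerProductSpace ℝ E]
    [CompleteSpace E] {f : E → ℝ} (hf : ConvexOn ℝ Set.univ f) {x : E}
    (hd : DifferentiableAt ℝ f x) (y : E) : f x + inner ℝ (gradient f x) (y - x) ≤ f y := by
  have hline : ConvexOn ℝ Set.univ (f ∘ AffineMap.lineMap (k := ℝ) x y) := by
    simpa using hf.comp_affineMap (AffineMap.lineMap (k := ℝ) x y)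
  have hderiv : HasDerivAt (f ∘ AffineMap.lineMap (k := ℝ) x y)
      (inner ℝ (gradient f x) (y - x)) 0 := by
    have h1 : HasFDerivAt f (InnerProductSpace.toDual ℝ E (gradient f x))
        (AffineMap.lineMap (k := ℝ) x y 0) := by
      rw [AffineMap.lineMap_apply_zero]
      exact hd.hasGradientAt.hasFDerivAt
    simpa using h1.comp_hasDerivAt (0 : ℝ) AffineMap.hasDerivAt_lineMap
  have h := hline.le_slope_of_hasDerivAt (Set.mem_univ 0) (Set.mem_univ 1) zero_lt_one hderiv
  simp only [slope_def_field, Function.comp_apply, AffineMap.lineMap_apply_one,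
    AffineMap.lineMap_apply_zero, sub_zero, div_one] at h
  linarith

/-! ### The nonnegative orthant -/

section NonnegOrthant

variable {q : ℕ}

theorem nonnegOrthant_nonempty : (nonnegOrthant q).Nonempty := ⟨0, fun _ => le_rfl⟩

theorem isClosed_nonnegOrthant : IsClosed (nonnegOrthant q) := by
  simp only [nonnegOrthant, Set.ofPred_forall]
  exact isClosed_iInter fun j => isClosed_le continuous_const (by fun_prop)

theorem convex_nonnegOrthant : Convex ℝ (nonnegOrthant q) := by
  intro x hx y hy a b ha hb _ j
  have := mul_nonneg ha (hx j)
  have := mul_nonneg hb (hy j)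
  simp only [PiLp.add_apply, PiLp.smul_apply, smul_eq_mul]
  linarith

theorem inner_nonneg_of_mem_nonnegOrthant {x y : EucVec q} (hx : x ∈ nonnegOrthant q)
    (hy : y ∈ nonnegOrthant q) : 0 ≤ inner ℝ x y := by
  rw [PiLp.inner_apply]
  exact Finset.sum_nonneg fun j _ => by simpa using mul_nonneg (hy j) (hx j)

end NonnegOrthant

/-! ### KKT pairs and Lagrange multipliers -/

/-- The Karush–Kuhn–Tucker conditions of the variational inequality of `F` over
`{u ∈ C | b - A u ∈ K*}`, for a multiplier in the cone `K`. -/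
structure IsKKTPair {E H : Type*} [NormedAddCommGroup E] [InnerProductSpace ℝ E]
    [NormedAddCommGroup H] [InnerProductSpace ℝ H] (C : Set E) (K : Set H) (F : E → E)
    (A : E →L[ℝ] H) (b : H) (u : E) (l : H) : Prop where
  mem_left : u ∈ C
  mem_right : l ∈ K
  stationary : ∀ w ∈ C, 0 ≤ inner ℝ (F u) (w - u) + inner ℝ (A (w - u)) l
  complementary : ∀ ν ∈ K, 0 ≤ inner ℝ (b - A u) (ν - l)

section Multiplier

variable {E : Type*} [NormedAddCommGroup E] [InnerProductSpace ℝ E] {q : ℕ}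

/-- Testing complementarity at l + e_j gives feasibility, and at 0 gives ⟨b - Au, l⟩ ≤ 0.
Stationarity then yields ⟨F u, v - u⟩ ≥ ⟨b - Av, l⟩ - ⟨b - Au, l⟩ ≥ 0. -/
theorem IsKKTPair.variationalInequality {C : Set E} {F : E → E} {A : E →L[ℝ] EucVec q}
    {b : EucVec q} {u : E} {l : EucVec q} (h : IsKKTPair C (nonnegOrthant q) F A b u l) :
    (∀ j, A u j ≤ b j) ∧
      ∀ v ∈ C, (∀ j, A v j ≤ b j) → 0 ≤ inner ℝ (F u) (v - u) := by
  have hfeas : ∀ j, A u j ≤ b j := by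
    intro j
    have h1 := h.complementary (l + EuclideanSpace.single j 1) fun i => by
      have := h.mem_right i
      by_cases hij : i = j
      · subst hij; simp; linarith
      · simpa [hij] using this
    rw [add_sub_cancel_left, EuclideanSpace.inner_single_right] at h1
    simpa using h1
  refine ⟨hfeas, fun v hv hAv => ?_⟩
  have h1 := h.stationary v hv
  have h2 := h.complementary 0 fun _ => le_rfl
  have h3 : 0 ≤ inner ℝ (b - A v) l :=
    inner_nonneg_of_mem_nonnegOrthant (fun j => by simpa using hAv j) h.mem_right
  simp only [map_sub, inner_sub_left, inner_sub_right, inner_zero_right] at *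
  linarith

/-- Existence of Lagrange multipliers under Slater's condition. -/
theorem exists_isKKTPair {C : Set E} (hC : Convex ℝ C) {F : E → E} {A : E →L[ℝ] EucVec q}
    {b : EucVec q} (hslater : ∃ u ∈ C, ∀ j, A u j < b j) {u : E} (hu : u ∈ C)
    (hAu : ∀ j, A u j ≤ b j)
    (hvi : ∀ v ∈ C, (∀ j, A v j ≤ b j) → 0 ≤ inner ℝ (F u) (v - u)) :
    ∃ l, IsKKTPair C (nonnegOrthant q) F A b u l := by
  -- The point u minimizes the linear function ⟨F u, · - u⟩ over the feasible set, so 0 lies outside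
  -- this open convex set of (constraint, objective) values strictly above attainable ones. A
  -- separating functional yields the multipliers.
  let S : Set (EucVec q × ℝ) :=
    {p | ∃ v ∈ C, inner ℝ (F u) (v - u) < p.2 ∧ ∀ j, A v j - b j < p.1 j}
  have hSopen : IsOpen S := by
    have : S = ⋃ v ∈ C, ({p : EucVec q × ℝ | inner ℝ (F u) (v - u) < p.2} ∩
        ⋂ j, {p : EucVec q × ℝ | A v j - b j < p.1 j}) := by
      ext p
      simp [S, and_left_comm]
    rw [this]
    exact isOpen_biUnion fun v _ => (isOpen_lt (by fun_prop) (by fun_prop)).inter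
      (isOpen_iInter_of_finite fun j => isOpen_lt (by fun_prop) (by fun_prop))
  have hSconv : Convex ℝ S := by
    refine convex_iff_forall_pos.2 ?_
    rintro ⟨s, c⟩ ⟨v, hv, hvc, hvs⟩ ⟨s', c'⟩ ⟨v', hv', hvc', hvs'⟩ α β hα hβ hαβ
    refine ⟨α • v + β • v', hC hv hv' hα.le hβ.le hαβ, ?_, fun j => ?_⟩
    · have e : α • v + β • v' - u = α • (v - u) + β • (v' - u) := by
        obtain rfl : β = 1 - α := by linarith
        module
      rw [e, inner_add_right, real_inner_smul_right, real_inner_smul_right]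
      exact add_lt_add (mul_lt_mul_of_pos_left hvc hα) (mul_lt_mul_of_pos_left hvc' hβ)
    · have h1 := mul_lt_mul_of_pos_left (hvs j) hα
      have h2 := mul_lt_mul_of_pos_left (hvs' j) hβ
      have h3 : b j = α * b j + β * b j := by rw [← add_mul, hαβ, one_mul]
      simp only [Prod.smul_mk, Prod.mk_add_mk, map_add, map_smul, PiLp.add_apply,
        PiLp.smul_apply, smul_eq_mul] at *
      linarith
  have h0 : (0 : EucVec q × ℝ) ∉ S := by
    rintro ⟨v, hv, hvc, hvs⟩
    exact absurd (hvi v hv fun j => by have := hvs j; simp at this; linarith) (not_le.2 hvc)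
  obtain ⟨f, hf⟩ := geometric_hahn_banach_open_point hSconv hSopen h0
  simp only [map_zero] at hf
  set α : ℝ := -f (0, 1) with hα
  set y : EucVec q := WithLp.toLp 2 fun j => -f (EuclideanSpace.single j 1, 0) with hy
  have hfeq : ∀ (s : EucVec q) (c : ℝ), f (s, c) = -(inner ℝ s y + α * c) := by
    intro s c
    have e1 : (s, c) = (∑ j, s j • ((EuclideanSpace.single j (1 : ℝ), (0 : ℝ)) : EucVec q × ℝ))
        + c • ((0 : EucVec q), (1 : ℝ)) := by
      refine Prod.ext ?_ ?_
      · ext i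
        simp [Prod.fst_sum, Pi.single_apply]
      · simp [Prod.snd_sum]
    rw [e1, map_add, map_sum, PiLp.inner_apply]
    simp only [map_smul]
    simp [hy, hα, mul_comm, add_comm]
  have key : ∀ v ∈ C, ∀ s : EucVec q, ∀ c : ℝ, inner ℝ (F u) (v - u) ≤ c →
      (∀ j, A v j - b j ≤ s j) → 0 ≤ inner ℝ s y + α * c := by
    intro v hv s c hc hs
    -- Raising all coordinates by ε > 0 lands in `S`; letting ε → 0 extends the sign of f to weak
    -- inequalities.
    have hcont : Tendsto (fun ε : ℝ => -f (s + ε • WithLp.toLp 2 (fun _ => (1 : ℝ)), c + ε))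
        (𝓝[>] 0) (𝓝 (-f (s + (0 : ℝ) • WithLp.toLp 2 (fun _ => (1 : ℝ)), c + 0))) :=
      (Continuous.tendsto (by fun_prop) 0).mono_left nhdsWithin_le_nhds
    have hnn := ge_of_tendsto hcont (b := 0) (by
      filter_upwards [self_mem_nhdsWithin] with ε hε
      have hε' : (0 : ℝ) < ε := hε
      have := hf (s + ε • WithLp.toLp 2 (fun _ => (1 : ℝ)), c + ε)
        ⟨v, hv, by simp only; linarith, fun j => by have := hs j; simp; linarith⟩
      linarith)
    rw [zero_smul, add_zero, add_zero, hfeq] at hnn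
    linarith
  have hynn : y ∈ nonnegOrthant q := by
    intro j
    by_contra! hneg
    -- If y_j < 0, raising the j-th slack by a large n violates `key`.
    obtain ⟨n, hn⟩ := exists_nat_gt
      ((inner ℝ (A u - b) y) / (-y j))
    rw [div_lt_iff₀ (by linarith)] at hn
    have h1 := key u hu (A u - b + (n : ℝ) • EuclideanSpace.single j 1) 0 (by simp) fun i => by
      by_cases hij : i = j
      · subst hij; simp
      · simp [hij]
    rw [inner_add_left, real_inner_smul_left, EuclideanSpace.inner_single_left] at h1
    simp at h1
    linarith
  obtain ⟨v₀, hv₀, hAv₀⟩ := hslater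
  -- Slater's point puts some (0, c) with c > 0 into `S`, which rules out a vanishing objective
  -- multiplier and permits division by α.
  have hαpos : 0 < α := by
    have h1 : 0 < α * (|inner ℝ (F u) (v₀ - u)| + 1) := by
      have := hf (0, |inner ℝ (F u) (v₀ - u)| + 1)
        ⟨v₀, hv₀, by linarith [le_abs_self (inner ℝ (F u) (v₀ - u))], fun j => by
          simpa using hAv₀ j⟩
      rw [hfeq, inner_zero_left] at this
      linarith
    exact pos_of_mul_pos_left h1 (by positivity)
  have hcs : inner ℝ (b - A u) y = 0 := by
    have h1 := key u hu (A u - b) 0 (by simp) fun i => by simp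
    have h2 : 0 ≤ inner ℝ (b - A u) y :=
      inner_nonneg_of_mem_nonnegOrthant (fun j => by simpa using hAu j) hynn
    simp only [inner_sub_left] at *
    linarith
  refine ⟨α⁻¹ • y, hu, fun j => mul_nonneg (inv_nonneg.2 hαpos.le) (hynn j), fun w hw => ?_,
    fun ν hν => ?_⟩
  · have h1 := key w hw (A w - b) _ le_rfl fun i => by simp
    have h2 : inner ℝ (A w - b) y = inner ℝ (A (w - u)) y := by
      rw [map_sub]
      simp only [inner_sub_left] at *
      linarith
    rw [h2] at h1
    have h3 := mul_nonneg (inv_nonneg.2 hαpos.le) h1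
    rw [real_inner_smul_right]
    have h4 : α⁻¹ * (inner ℝ (A (w - u)) y + α * inner ℝ (F u) (w - u))
        = inner ℝ (F u) (w - u) + α⁻¹ * inner ℝ (A (w - u)) y := by
      field_simp
      ring
    linarith
  · rw [inner_sub_right, real_inner_smul_right, hcs, mul_zero, sub_zero]
    exact inner_nonneg_of_mem_nonnegOrthant (fun j => by simpa using hAu j) hν

end Multiplier

/-! ### Lyapunov analysis of the primal–dual flow -/

section PrimalDual

variable {E H : Type*} [NormedAddCommGroup E] [InnerProductSpace ℝ E]
  [NormedAddCommGroup H] [InnerProductSpace ℝ H]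

/-- One step of the preconditioned forward-backward splitting: `(u + du, l + dl)` is the image of
`(u, l)`, where the projection onto `C` is taken in the metric of `D`. -/
structure IsPrimalDualStep (C : Set E) (K : Set H) (F : E → E) (A : E →L[ℝ] H) (b : H)
    (D : E →L[ℝ] E) (γ₀ : ℝ) (u : E) (l : H) (du : E) (dl : H) : Prop where
  mem_left : u + du ∈ C
  mem_right : l + dl ∈ K
  left : ∀ w ∈ C, 0 ≤ inner ℝ (D du + F u) (w - (u + du)) + inner ℝ (A (w - (u + du))) l
  right : ∀ ν ∈ K, 0 ≤ inner ℝ (γ₀⁻¹ • dl - (A u - b + (2 : ℝ) • A du)) (ν - (l + dl))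

variable {C : Set E} {K : Set H} {F : E → E} {A : E →L[ℝ] H} {b : H} {D : E →L[ℝ] E} {γ₀ : ℝ}

/-- The squared norm of `(x, y)` in the metric of the preconditioner. -/
def lyapunov (A : E →L[ℝ] H) (D : E →L[ℝ] E) (γ₀ : ℝ) (x : E) (y : H) : ℝ :=
  inner ℝ (D x) x - 2 * inner ℝ (A x) y + γ₀⁻¹ * inner ℝ y y

/-- The cross term satisfies 2⟨Ax, y⟩ ≤ ‖A‖(‖x‖² + ‖y‖²). -/
theorem le_lyapunov {κ : ℝ} (hD : ∀ x, κ * ‖x‖ ^ 2 ≤ inner ℝ (D x) x) (hγ₀ : κ ≤ γ₀⁻¹) (x : E)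
    (y : H) : (κ - ‖A‖) * (‖x‖ ^ 2 + ‖y‖ ^ 2) ≤ lyapunov A D γ₀ x y := by
  have h1 := hD x
  have h2 := mul_le_mul_of_nonneg_right hγ₀ (sq_nonneg ‖y‖)
  have h3 : inner ℝ (A x) y ≤ ‖A‖ * ‖x‖ * ‖y‖ := (real_inner_le_norm _ _).trans
    (mul_le_mul_of_nonneg_right (A.le_opNorm x) (norm_nonneg _))
  have h4 : 0 ≤ ‖A‖ * (‖x‖ - ‖y‖) ^ 2 := by positivity
  rw [lyapunov, real_inner_self_eq_norm_sq]
  nlinarith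

theorem continuous_lyapunov (p : E × H) :
    Continuous fun z : E × H => lyapunov A D γ₀ (z.1 - p.1) (z.2 - p.2) := by
  unfold lyapunov
  fun_prop

theorem hasDerivWithinAt_lyapunov (hDsymm : ∀ x y, inner ℝ (D x) y = inner ℝ x (D y))
    {u : ℝ → E} {l : ℝ → H} {du : E} {dl : H} {s : Set ℝ} {t : ℝ}
    (hu : HasDerivWithinAt u du s t) (hl : HasDerivWithinAt l dl s t) (p : E × H) :
    HasDerivWithinAt (fun t => lyapunov A D γ₀ (u t - p.1) (l t - p.2))
      (2 * (inner ℝ (D (u t - p.1)) du - inner ℝ (A du) (l t - p.2)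
        - inner ℝ (A (u t - p.1)) dl + γ₀⁻¹ * inner ℝ (l t - p.2) dl)) s t := by
  have hu' := hu.sub_const p.1
  have hl' := hl.sub_const p.2
  have hA := A.hasFDerivAt.comp_hasDerivWithinAt t hu'
  have hD := D.hasFDerivAt.comp_hasDerivWithinAt t hu'
  have h := ((hD.inner ℝ hu').sub ((hA.inner ℝ hl').const_mul 2)).add
    ((hl'.inner ℝ hl').const_mul γ₀⁻¹)
  refine h.congr_deriv ?_
  simp only [Function.comp_apply]
  rw [hDsymm du, real_inner_comm (D (u t - p.1)) du, real_inner_comm (l t - p.2) dl]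
  ring

/-- The decrease of the Lyapunov function along the step. -/
theorem IsPrimalDualStep.lyapunov_le {L μ κ : ℝ} (hμ : 0 < μ)
    (hDsymm : ∀ x y, inner ℝ (D x) y = inner ℝ x (D y))
    (hL : ∀ u v, ‖F u - F v‖ ≤ L * ‖u - v‖)
    (hF : ∀ u v, μ * ‖u - v‖ ^ 2 ≤ inner ℝ (u - v) (F u - F v))
    (hκ : ‖A‖ + L ^ 2 / (4 * μ) + 1 ≤ κ) (hD : ∀ x, κ * ‖x‖ ^ 2 ≤ inner ℝ (D x) x)
    (hγ₀ : κ ≤ γ₀⁻¹) {u : E} {l : H} {du : E} {dl : H}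
    (h : IsPrimalDualStep C K F A b D γ₀ u l du dl) {p : E × H}
    (hp : IsKKTPair C K F A b p.1 p.2) :
    inner ℝ (D (u - p.1)) du - inner ℝ (A du) (l - p.2) - inner ℝ (A (u - p.1)) dl
      + γ₀⁻¹ * inner ℝ (l - p.2) dl ≤ -(‖du‖ ^ 2 + ‖dl‖ ^ 2) := by
  obtain ⟨u₁, l₁⟩ := p
  simp only at hp ⊢
  have h1 := h.left u₁ hp.mem_left
  have h2 := h.right l₁ hp.mem_right
  have h3 := hp.stationary _ h.mem_left
  have h4 := hp.complementary _ h.mem_right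
  have h5 := hD du
  have h6 := mul_le_mul_of_nonneg_right hγ₀ (sq_nonneg ‖dl‖)
  have h7 : inner ℝ (A du) dl ≤ ‖A‖ * ‖du‖ * ‖dl‖ := (real_inner_le_norm _ _).trans
    (mul_le_mul_of_nonneg_right (A.le_opNorm du) (norm_nonneg _))
  have h8 := hF u u₁
  have h9 : -(L * ‖u - u₁‖ * ‖du‖) ≤ inner ℝ (F u - F u₁) du :=
    (neg_le_neg (mul_le_mul_of_nonneg_right (hL u u₁) (norm_nonneg _))).trans
      (neg_le_of_abs_le (abs_real_inner_le_norm _ _))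
  obtain ⟨x, rfl⟩ : ∃ x, u = u₁ + x := ⟨u - u₁, by abel⟩
  obtain ⟨y, rfl⟩ : ∃ y, l = l₁ + y := ⟨l - l₁, by abel⟩
  have e1 : u₁ - (u₁ + x + du) = -(x + du) := by abel
  have e2 : l₁ - (l₁ + y + dl) = -(y + dl) := by abel
  have e3 : u₁ + x + du - u₁ = x + du := by abel
  have e4 : l₁ + y + dl - l₁ = y + dl := by abel
  rw [e1] at h1
  rw [e2] at h2
  rw [e3] at h3
  rw [e4] at h4
  rw [add_sub_cancel_left] at h8 h9 ⊢
  rw [add_sub_cancel_left]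
  rw [real_inner_comm] at h8
  -- Sum of the four inequalities: the step tested at the KKT pair, and the KKT pair tested at the
  -- endpoint of the step. In terms of P this reads ⟨z - z*, P ż⟩ + ⟨ż, P ż⟩ + ⟨F u - F u₁, x + du⟩
  -- ≤ 0.
  have hsum : inner ℝ (D x) du - inner ℝ (A du) y - inner ℝ (A x) dl + γ₀⁻¹ * inner ℝ y dl
      + (inner ℝ (D du) du - 2 * inner ℝ (A du) dl + γ₀⁻¹ * ‖dl‖ ^ 2)
      + inner ℝ (F (u₁ + x) - F u₁) x + inner ℝ (F (u₁ + x) - F u₁) du ≤ 0 := by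
    rw [← real_inner_self_eq_norm_sq, hDsymm, real_inner_comm (D du) x, real_inner_comm dl y]
    simp only [map_add, map_neg, inner_add_left, inner_add_right, inner_sub_left, inner_neg_left,
      inner_neg_right, real_inner_smul_left] at *
    linarith
  -- Young's inequality, weighted so that strong monotonicity pays exactly for the ‖x‖² term; the
  -- rest is charged to κ.
  have h10 : L * ‖x‖ * ‖du‖ ≤ μ * ‖x‖ ^ 2 + L ^ 2 / (4 * μ) * ‖du‖ ^ 2 := by
    have e : μ * ‖x‖ ^ 2 + L ^ 2 / (4 * μ) * ‖du‖ ^ 2 - L * ‖x‖ * ‖du‖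
        = μ * (‖x‖ - L / (2 * μ) * ‖du‖) ^ 2 := by
      field_simp
      ring
    have : 0 ≤ μ * (‖x‖ - L / (2 * μ) * ‖du‖) ^ 2 := by positivity
    linarith
  have h11 : 0 ≤ ‖A‖ * (‖du‖ - ‖dl‖) ^ 2 := by positivity
  have h12 := mul_le_mul_of_nonneg_right hκ (sq_nonneg ‖du‖)
  have h13 := mul_le_mul_of_nonneg_right hκ (sq_nonneg ‖dl‖)
  have h14 : 0 ≤ L ^ 2 / (4 * μ) * ‖dl‖ ^ 2 := by positivity
  linarith

theorem exists_isKKTPair_tendsto [FiniteDimensional ℝ E] [FiniteDimensional ℝ H]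
    (hC : IsClosed C) (hK : IsClosed K) {L μ κ : ℝ} (hμ : 0 < μ)
    (hL : ∀ u v, ‖F u - F v‖ ≤ L * ‖u - v‖)
    (hF : ∀ u v, μ * ‖u - v‖ ^ 2 ≤ inner ℝ (u - v) (F u - F v))
    (hDsymm : ∀ x y, inner ℝ (D x) y = inner ℝ x (D y))
    (hκ : ‖A‖ + L ^ 2 / (4 * μ) + 1 ≤ κ) (hD : ∀ x, κ * ‖x‖ ^ 2 ≤ inner ℝ (D x) x)
    (hγ₀ : κ ≤ γ₀⁻¹) {p₀ : E × H} (hp₀ : IsKKTPair C K F A b p₀.1 p₀.2)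
    {u du : ℝ → E} {l dl : ℝ → H}
    (hu : ∀ t, 0 ≤ t → HasDerivWithinAt u (du t) (Set.Ici 0) t)
    (hl : ∀ t, 0 ≤ t → HasDerivWithinAt l (dl t) (Set.Ici 0) t)
    (hstep : ∀ t, 0 ≤ t → IsPrimalDualStep C K F A b D γ₀ (u t) (l t) (du t) (dl t)) :
    ∃ p : E × H, IsKKTPair C K F A b p.1 p.2 ∧ Tendsto (fun t => (u t, l t)) atTop (𝓝 p) := by
  set V : E × H → ℝ → ℝ := fun p t => lyapunov A D γ₀ (u t - p.1) (l t - p.2) with hV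
  set V' : E × H → ℝ → ℝ := fun p t => 2 * (inner ℝ (D (u t - p.1)) (du t)
    - inner ℝ (A (du t)) (l t - p.2) - inner ℝ (A (u t - p.1)) (dl t)
    + γ₀⁻¹ * inner ℝ (l t - p.2) (dl t)) with hV'
  have hderiv : ∀ p, ∀ t, 0 ≤ t → HasDerivWithinAt (V p) (V' p t) (Set.Ici 0) t :=
    fun p t ht => hasDerivWithinAt_lyapunov hDsymm (hu t ht) (hl t ht) p
  have hdecr : ∀ p : E × H, IsKKTPair C K F A b p.1 p.2 → ∀ t, 0 ≤ t →
      V' p t ≤ -2 * (‖du t‖ ^ 2 + ‖dl t‖ ^ 2) := by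
    intro p hp t ht
    have := (hstep t ht).lyapunov_le hμ hDsymm hL hF hκ hD hγ₀ hp
    simp only [hV']
    linarith
  have hcoer : ∀ p t, ‖u t - p.1‖ ^ 2 + ‖l t - p.2‖ ^ 2 ≤ V p t := by
    intro p t
    refine le_trans ?_ (le_lyapunov (A := A) hD hγ₀ _ _)
    have : 0 ≤ L ^ 2 / (4 * μ) := by positivity
    nlinarith [sq_nonneg ‖u t - p.1‖, sq_nonneg ‖l t - p.2‖]
  -- The case c = 0 gives monotonicity of V; c > 0 gives linear decrease, impossible for V ≥ 0,
  -- hence times with arbitrarily small velocity.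
  have hanti_aux : ∀ (p : E × H) (c T : ℝ), 0 ≤ T → (∀ t, T ≤ t → V' p t ≤ -c) →
      AntitoneOn (fun t => V p t + c * t) (Set.Ici T) := by
    intro p c T hT hc
    have hd : ∀ t, T ≤ t → HasDerivWithinAt (fun t => V p t + c * t) (V' p t + c)
        (Set.Ici T) t := fun t ht => by
      have h1 := ((hderiv p t (hT.trans ht)).mono (Set.Ici_subset_Ici.2 hT)).add
        (((hasDerivAt_id t).const_mul c).hasDerivWithinAt (s := Set.Ici T))
      exact h1.congr_deriv (by simp)
    refine antitoneOn_of_hasDerivWithinAt_nonpos (convex_Ici T)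
      (f' := fun t => V' p t + c) (fun t ht => (hd t ht).continuousWithinAt) ?_ ?_
    · intro t ht
      exact (hd t (interior_subset ht)).mono interior_subset
    · intro t ht
      linarith [hc t (interior_subset ht)]
  have hanti : ∀ p : E × H, IsKKTPair C K F A b p.1 p.2 → AntitoneOn (V p) (Set.Ici 0) := by
    intro p hp
    simpa using hanti_aux p 0 0 le_rfl fun t ht => by
      have := hdecr p hp t ht
      have : 0 ≤ ‖du t‖ ^ 2 + ‖dl t‖ ^ 2 := by positivity
      linarith
  have hsmall : ∀ n : ℕ, ∃ t : ℝ, (n : ℝ) ≤ t ∧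
      ‖du t‖ ^ 2 + ‖dl t‖ ^ 2 < 1 / ((n : ℝ) + 1) := by
    intro n
    by_contra! hcon
    have hn : (0 : ℝ) < 1 / ((n : ℝ) + 1) := Nat.one_div_pos_of_nat
    have hn0 : (0 : ℝ) ≤ n := n.cast_nonneg
    have ha := hanti_aux p₀ (1 / ((n : ℝ) + 1)) n hn0 fun t ht => by
      have := hdecr p₀ hp₀ t (hn0.trans ht)
      have := hcon t ht
      linarith
    obtain ⟨k, hk⟩ := exists_nat_gt (V p₀ n / (1 / ((n : ℝ) + 1)))
    rw [div_lt_iff₀ hn] at hk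
    have h1 := ha (Set.mem_Ici.2 le_rfl) (show (n : ℝ) + k ∈ Set.Ici (n : ℝ) by simp) (by simp)
    have h2 := hcoer p₀ (n + k)
    have h3 : 0 ≤ ‖u (n + k) - p₀.1‖ ^ 2 + ‖l (n + k) - p₀.2‖ ^ 2 := by positivity
    simp only at h1
    nlinarith
  choose τ hτn hτ using hsmall
  have hτ0 : ∀ n, 0 ≤ τ n := fun n => n.cast_nonneg.trans (hτn n)
  have hdu : Tendsto (fun n => du (τ n)) atTop (𝓝 0) := by
    rw [tendsto_zero_iff_norm_tendsto_zero]
    have : Tendsto (fun n => ‖du (τ n)‖ ^ 2) atTop (𝓝 0) :=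
      squeeze_zero (fun n => by positivity)
        (fun n => by linarith [hτ n, sq_nonneg ‖dl (τ n)‖]) tendsto_one_div_add_atTop_nhds_zero_nat
    simpa [Real.sqrt_sq] using this.sqrt
  have hdl : Tendsto (fun n => dl (τ n)) atTop (𝓝 0) := by
    rw [tendsto_zero_iff_norm_tendsto_zero]
    have : Tendsto (fun n => ‖dl (τ n)‖ ^ 2) atTop (𝓝 0) :=
      squeeze_zero (fun n => by positivity)
        (fun n => by linarith [hτ n, sq_nonneg ‖du (τ n)‖]) tendsto_one_div_add_atTop_nhds_zero_nat
    simpa [Real.sqrt_sq] using this.sqrt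
  have hbdd : ∀ n, (u (τ n), l (τ n)) ∈ Metric.closedBall p₀ √(V p₀ 0) := by
    intro n
    have h1 := hanti p₀ hp₀ (Set.mem_Ici.2 le_rfl) (hτ0 n) (hτ0 n)
    have h2 := hcoer p₀ (τ n)
    rw [Metric.mem_closedBall, dist_eq_norm, Prod.norm_def]
    refine max_le (Real.le_sqrt_of_sq_le ?_) (Real.le_sqrt_of_sq_le ?_)
    · simp only [Prod.fst_sub]
      linarith [sq_nonneg ‖l (τ n) - p₀.2‖]
    · simp only [Prod.snd_sub]
      linarith [sq_nonneg ‖u (τ n) - p₀.1‖]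
  have : ProperSpace E := FiniteDimensional.proper ℝ E
  have : ProperSpace H := FiniteDimensional.proper ℝ H
  obtain ⟨p, -, φ, hφ, hlim⟩ := tendsto_subseq_of_bounded Metric.isBounded_closedBall hbdd
  have hFc : Continuous F := by
    -- The sign of L is not assumed, hence the maximum with 0.
    refine (LipschitzWith.of_dist_le_mul (K := (max L 0).toNNReal) fun x y => ?_).continuous
    rw [dist_eq_norm, dist_eq_norm, Real.coe_toNNReal _ (le_max_right _ _)]
    exact (hL x y).trans (mul_le_mul_of_nonneg_right (le_max_left _ _) (norm_nonneg _))
  have hulim : Tendsto (fun n => u (τ (φ n))) atTop (𝓝 p.1) :=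
    (continuous_fst.tendsto p).comp hlim
  have hllim : Tendsto (fun n => l (τ (φ n))) atTop (𝓝 p.2) :=
    (continuous_snd.tendsto p).comp hlim
  have hdu' := hdu.comp hφ.tendsto_atTop
  have hdl' := hdl.comp hφ.tendsto_atTop
  have hjoint : Tendsto (fun n => ((u (τ (φ n)), l (τ (φ n))), (du (τ (φ n)), dl (τ (φ n)))))
      atTop (𝓝 ((p.1, p.2), ((0 : E), (0 : H)))) :=
    (hulim.prodMk_nhds hllim).prodMk_nhds (hdu'.prodMk_nhds hdl')
  -- At zero velocity the step inequalities are the KKT conditions, and they pass to the limit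
  -- because C and K are closed and F is continuous.
  have hp : IsKKTPair C K F A b p.1 p.2 := by
    refine ⟨?_, ?_, fun w hw => ?_, fun ν hν => ?_⟩
    · refine hC.mem_of_tendsto (by simpa using hulim.add hdu')
        (Eventually.of_forall fun n => (hstep _ (hτ0 (φ n))).mem_left)
    · refine hK.mem_of_tendsto (by simpa using hllim.add hdl')
        (Eventually.of_forall fun n => (hstep _ (hτ0 (φ n))).mem_right)
    · have hc : Continuous fun z : (E × H) × (E × H) =>
          inner ℝ (D z.2.1 + F z.1.1) (w - (z.1.1 + z.2.1))
            + inner ℝ (A (w - (z.1.1 + z.2.1))) z.1.2 := by fun_prop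
      simpa using ge_of_tendsto ((hc.tendsto _).comp hjoint)
        (Eventually.of_forall fun n => (hstep _ (hτ0 (φ n))).left w hw)
    · have hc : Continuous fun z : (E × H) × (E × H) =>
          inner ℝ (γ₀⁻¹ • z.2.2 - (A z.1.1 - b + (2 : ℝ) • A z.2.1)) (ν - (z.1.2 + z.2.2)) := by
        fun_prop
      simpa using ge_of_tendsto ((hc.tendsto _).comp hjoint)
        (Eventually.of_forall fun n => (hstep _ (hτ0 (φ n))).right ν hν)
  refine ⟨p, hp, ?_⟩
  have hVsub : Tendsto (fun n => V p (τ (φ n))) atTop (𝓝 0) := by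
    have := ((continuous_lyapunov (A := A) (D := D) (γ₀ := γ₀) p).tendsto p).comp hlim
    have h0 : lyapunov A D γ₀ (p.1 - p.1) (p.2 - p.2) = 0 := by simp [lyapunov]
    exact h0 ▸ this
  have hVlim : Tendsto (V p) atTop (𝓝 0) := by
    rw [Metric.tendsto_atTop]
    intro ε hε
    obtain ⟨n, hn⟩ := (hVsub.eventually_lt_const hε).exists
    refine ⟨τ (φ n), fun t ht => ?_⟩
    have h1 := hanti p hp (hτ0 (φ n)) ((hτ0 (φ n)).trans ht) ht
    have h2 : 0 ≤ V p t := le_trans (by positivity) (hcoer p t)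
    rw [Real.dist_eq, sub_zero, abs_of_nonneg h2]
    exact h1.trans_lt hn
  refine Tendsto.prodMk_nhds ?_ ?_
  · rw [tendsto_iff_norm_sub_tendsto_zero]
    have : Tendsto (fun t => ‖u t - p.1‖ ^ 2) atTop (𝓝 0) :=
      squeeze_zero (fun t => by positivity)
        (fun t => by linarith [hcoer p t, sq_nonneg ‖l t - p.2‖]) hVlim
    simpa [Real.sqrt_sq] using this.sqrt
  · rw [tendsto_iff_norm_sub_tendsto_zero]
    have : Tendsto (fun t => ‖l t - p.2‖ ^ 2) atTop (𝓝 0) :=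
      squeeze_zero (fun t => by positivity)
        (fun t => by linarith [hcoer p t, sq_nonneg ‖u t - p.1‖]) hVlim
    simpa [Real.sqrt_sq] using this.sqrt

end PrimalDual

/-! ### Block structure of the decision space -/

section Blocks

variable {N : ℕ} {m : Fin N → ℕ}

theorem withBlock_self (u : JointVec m) (i : Fin N) : withBlock u i (u i) = u := by
  ext j : 1
  simp [withBlock]

theorem withBlock_apply_self (u : JointVec m) (i : Fin N) (v : EucVec (m i)) :
    withBlock u i v i = v := by
  simp [withBlock]

theorem withBlock_apply_of_ne (u : JointVec m) {i j : Fin N} (h : j ≠ i) (v : EucVec (m i)) :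
    withBlock u i v j = u j := by
  simp [withBlock, h]

theorem hasFDerivAt_withBlock (u : JointVec m) (i : Fin N) (v : EucVec (m i)) :
    HasFDerivAt (withBlock u i)
      ((PiLp.continuousLinearEquiv 2 ℝ fun i => EucVec (m i)).symm.toContinuousLinearMap ∘L
        ContinuousLinearMap.pi (Pi.single i (ContinuousLinearMap.id ℝ (EucVec (m i))))) v :=
  (PiLp.continuousLinearEquiv 2 ℝ fun i => EucVec (m i)).symm.toContinuousLinearMap.hasFDerivAt.comp
    v (hasFDerivAt_update (fun j => u j) v)

/-- Multiplication of the `i`-th block by `c i`. -/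
def blockScale (c : Fin N → ℝ) : JointVec m →L[ℝ] JointVec m :=
  LinearMap.toContinuousLinearMap
    { toFun := fun u => WithLp.toLp 2 fun i => c i • u i
      map_add' := fun u v => by ext i : 1; simp
      map_smul' := fun a u => by ext i : 1; simp [smul_comm a] }

theorem blockScale_apply (c : Fin N → ℝ) (u : JointVec m) (i : Fin N) :
    blockScale c u i = c i • u i := rfl

theorem inner_blockScale_left (c : Fin N → ℝ) (u v : JointVec m) :
    inner ℝ (blockScale c u) v = inner ℝ u (blockScale c v) := by
  simp only [PiLp.inner_apply (𝕜 := ℝ) (f := fun i => EucVec (m i)), blockScale_apply,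
    real_inner_smul_left, real_inner_smul_right]

theorem le_inner_blockScale_self {c : Fin N → ℝ} {κ : ℝ} (hc : ∀ i, κ ≤ c i) (u : JointVec m) :
    κ * ‖u‖ ^ 2 ≤ inner ℝ (blockScale c u) u := by
  rw [PiLp.norm_sq_eq_of_L2, PiLp.inner_apply, Finset.mul_sum]
  refine Finset.sum_le_sum fun i _ => ?_
  rw [blockScale_apply, real_inner_smul_left, real_inner_self_eq_norm_sq]
  exact mul_le_mul_of_nonneg_right (hc i) (sq_nonneg _)

end Blocks

/-! ### The game as a variational inequality and a primal–dual flow -/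

namespace GNEGame

variable {N : ℕ} {m : Fin N → ℕ} {q : ℕ} (G : GNEGame N m q)

/-- The product of the local constraint sets. -/
def localSet : Set (JointVec m) := {u | ∀ i, u i ∈ G.Ω i}

/-- The coupling matrix as a continuous linear map. -/
def couplingMap : JointVec m →L[ℝ] EucVec q :=
  LinearMap.toContinuousLinearMap
    { toFun := G.mulA
      map_add' := fun u v => by
        ext j
        simp [mulA, Matrix.mulVec, dotProduct, mul_add, Finset.sum_add_distrib]
      map_smul' := fun a u => by
        ext j
        simp [mulA, Matrix.mulVec, dotProduct, Finset.mul_sum, mul_left_comm] }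

theorem couplingMap_apply (u : JointVec m) : G.couplingMap u = G.mulA u := rfl

theorem inner_couplingMap_left (w : JointVec m) (l : EucVec q) :
    inner ℝ (G.couplingMap w) l = ∑ i, inner ℝ (G.mulAT i l) (w i) := by
  simp only [couplingMap_apply, mulA, mulAT, PiLp.inner_apply, Matrix.mulVec, dotProduct,
    Matrix.transpose_apply, Finset.sum_apply, RCLike.inner_apply, conj_trivial,
    Finset.mul_sum]
  rw [Finset.sum_comm]
  refine Finset.sum_congr rfl fun i _ => ?_
  rw [Finset.sum_comm]
  exact Finset.sum_congr rfl fun k _ => Finset.sum_congr rfl fun j _ => by ring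

theorem hasGradientAt_withBlock {i : Fin N} (hd : Differentiable ℝ (G.J i)) (u : JointVec m) :
    HasGradientAt (fun v => G.J i (withBlock u i v)) (gradient (G.J i) u i) (u i) := by
  have h1 : HasFDerivAt (G.J i) (InnerProductSpace.toDual ℝ _ (gradient (G.J i) u))
      (withBlock u i (u i)) := by
    rw [withBlock_self]
    exact (hd u).hasGradientAt.hasFDerivAt
  refine (h1.comp (u i) (hasFDerivAt_withBlock u i (u i))).congr_fderiv ?_
  ext h
  simp only [ContinuousLinearMap.comp_apply, InnerProductSpace.toDual_apply_apply]
  rw [PiLp.inner_apply, Finset.sum_eq_single i]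
  · simp
  · intro j _ hj
    simp [hj]
  · simp

theorem partialGrad_eq {i : Fin N} (hd : Differentiable ℝ (G.J i)) (u : JointVec m) :
    G.partialGrad i u = gradient (G.J i) u i :=
  (G.hasGradientAt_withBlock hd u).gradient

variable {G} {ℓ μ : ℝ}

namespace StandingAssumptions

variable (hG : G.StandingAssumptions ℓ μ)
include hG

/-- Block i is a block of the ℓ-Lipschitz full gradient of J_i; summing N squares produces √N. -/
theorem norm_pseudoGrad_sub_le (u v : JointVec m) :
    ‖G.pseudoGrad u - G.pseudoGrad v‖ ≤ (√N * ℓ) * ‖u - v‖ := by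
  have h0 : 0 ≤ √N * ℓ * ‖u - v‖ :=
    mul_nonneg (mul_nonneg (Real.sqrt_nonneg _) hG.ℓ_pos.le) (norm_nonneg _)
  refine le_of_sq_le_sq ?_ h0
  rw [PiLp.norm_sq_eq_of_L2, mul_pow, mul_pow, Real.sq_sqrt N.cast_nonneg]
  have h : ∀ i ∈ Finset.univ, ‖(G.pseudoGrad u - G.pseudoGrad v) i‖ ^ 2 ≤ (ℓ * ‖u - v‖) ^ 2 := by
    intro i _
    refine pow_le_pow_left₀ (norm_nonneg _) ?_ 2
    have e : (G.pseudoGrad u - G.pseudoGrad v) i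
        = (gradient (G.J i) u - gradient (G.J i) v) i := by
      simp [pseudoGrad, G.partialGrad_eq (hG.J_differentiable i)]
    rw [e]
    exact (PiLp.norm_apply_le _ i).trans (hG.grad_lipschitz i u v)
  refine (Finset.sum_le_sum h).trans (le_of_eq ?_)
  simp
  ring

theorem isClosed_localSet : IsClosed G.localSet := by
  simp only [localSet, Set.ofPred_forall]
  exact isClosed_iInter fun i => (hG.Ω_closed i).preimage (by fun_prop)

theorem convex_localSet : Convex ℝ G.localSet :=
  fun _ hx _ hy _ _ ha hb hab i => hG.Ω_convex i (hx i) (hy i) ha hb hab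

theorem isClosed_feasible : IsClosed G.feasible := by
  have : G.feasible = G.localSet ∩ ⋂ j, {u | G.couplingMap u j ≤ G.b j} := by
    ext u
    simp [feasible, localSet, couplingMap_apply]
  rw [this]
  exact hG.isClosed_localSet.inter
    (isClosed_iInter fun j => isClosed_le (by fun_prop) continuous_const)

theorem convex_feasible : Convex ℝ G.feasible := by
  intro x hx y hy α β hα hβ hαβ
  refine ⟨hG.convex_localSet hx.1 hy.1 hα hβ hαβ, fun j => ?_⟩
  have h1 := mul_le_mul_of_nonneg_left (hx.2 j) hα
  have h2 := mul_le_mul_of_nonneg_left (hy.2 j) hβ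
  have h3 : G.b j = α * G.b j + β * G.b j := by rw [← add_mul, hαβ, one_mul]
  rw [← couplingMap_apply] at *
  simp only [map_add, map_smul, PiLp.add_apply, PiLp.smul_apply, smul_eq_mul]
  linarith

theorem feasible_nonempty : G.feasible.Nonempty := by
  obtain ⟨u, hu, hAu⟩ := hG.slater
  exact ⟨u, hu, fun j => (hAu j).le⟩

/-- Feasible solutions of the variational inequality are variational equilibria. -/
theorem isVariationalGNE {u : JointVec m} (hu : u ∈ G.feasible)
    (hvi : ∀ v ∈ G.feasible, 0 ≤ inner ℝ (G.pseudoGrad u) (v - u)) : G.IsVariationalGNE u := by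
  refine ⟨⟨hu, fun i v _ hv' => ?_⟩, hvi⟩
  have h1 := (hG.J_convex i u).add_inner_gradient_le
    (G.hasGradientAt_withBlock (hG.J_differentiable i) u).differentiableAt v
  have h2 := hvi _ hv'
  -- A unilateral deviation changes only block i, so the variational inequality reduces to the
  -- first-order condition of agent i.
  rw [PiLp.inner_apply, Finset.sum_eq_single i] at h2
  · simp only [PiLp.sub_apply, withBlock_apply_self] at h2
    rw [withBlock_self] at h1
    have h3 : inner ℝ (gradient (fun v => G.J i (withBlock u i v)) (u i)) (v - u i)
        = inner ℝ (G.pseudoGrad u i) (v - u i) := rfl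
    linarith
  · intro j _ hj
    simp [withBlock_apply_of_ne u hj]
  · simp

theorem existsUnique_isVariationalGNE : ∃! u, G.IsVariationalGNE u := by
  obtain ⟨u, hu, hvi⟩ := exists_variationalInequality_solution hG.feasible_nonempty
    hG.isClosed_feasible hG.convex_feasible hG.μ_pos hG.norm_pseudoGrad_sub_le
    hG.strongly_monotone
  exact ⟨u, hG.isVariationalGNE hu hvi, fun v hv =>
    variationalInequality_unique hG.μ_pos hG.strongly_monotone hv.1.1 hv.2 hu hvi⟩

/-- A velocity of the projected primal–dual dynamics is a primal–dual step. -/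
theorem isPrimalDualStep {γ : Fin N → ℝ} (hγ : ∀ i, 0 < γ i) {γ₀ : ℝ} (hγ₀ : 0 < γ₀)
    {u du : JointVec m} {l dl : EucVec q}
    (hdu : ∀ i, du i = -(u i) + proj (G.Ω i) (u i - γ i • (G.partialGrad i u + G.mulAT i l)))
    (hdl : dl = -l + proj (nonnegOrthant q) (l + γ₀ • (G.mulA u - G.b + (2 : ℝ) • G.mulA du))) :
    IsPrimalDualStep G.localSet (nonnegOrthant q) G.pseudoGrad G.couplingMap G.b
      (blockScale fun i => (γ i)⁻¹) γ₀ u l du dl := by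
  have hp : ∀ i, proj (G.Ω i) (u i - γ i • (G.partialGrad i u + G.mulAT i l)) = (u + du) i :=
    fun i => by rw [PiLp.add_apply, hdu i]; abel
  have hspec := fun i => proj_mem_and_inner_le_zero (hG.Ω_nonempty i) (hG.Ω_closed i)
    (hG.Ω_convex i) (u i - γ i • (G.partialGrad i u + G.mulAT i l))
  simp only [hp] at hspec
  have hp₀ : proj (nonnegOrthant q) (l + γ₀ • (G.mulA u - G.b + (2 : ℝ) • G.mulA du)) = l + dl := by
    rw [hdl]; abel
  obtain ⟨hmem, hvi⟩ := proj_mem_and_inner_le_zero nonnegOrthant_nonempty isClosed_nonnegOrthant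
    convex_nonnegOrthant (l + γ₀ • (G.mulA u - G.b + (2 : ℝ) • G.mulA du))
  rw [hp₀] at hmem hvi
  refine ⟨fun i => (hspec i).1, hmem, fun w hw => ?_, fun ν hν => ?_⟩
  · rw [inner_couplingMap_left, PiLp.inner_apply, ← Finset.sum_add_distrib]
    refine Finset.sum_nonneg fun i _ => ?_
    have h := (hspec i).2 (w i) (hw i)
    -- Factoring γ_i out of the projection residual produces the weight 1/γ_i of the metric D.
    have e : u i - γ i • (G.partialGrad i u + G.mulAT i l) - (u + du) i
        = -(γ i • ((γ i)⁻¹ • du i + G.partialGrad i u + G.mulAT i l)) := by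
      rw [smul_add (γ i), smul_add (γ i), smul_add (γ i), smul_inv_smul₀ (hγ i).ne',
        PiLp.add_apply]
      abel
    rw [e, inner_neg_left, real_inner_smul_left, neg_nonpos] at h
    have h' := nonneg_of_mul_nonneg_right h (hγ i)
    rw [inner_add_left] at h'
    exact h'
  · have h := hvi ν hν
    have e : l + γ₀ • (G.mulA u - G.b + (2 : ℝ) • G.mulA du) - (l + dl)
        = -(γ₀ • (γ₀⁻¹ • dl - (G.mulA u - G.b + (2 : ℝ) • G.mulA du))) := by
      rw [smul_sub γ₀, smul_inv_smul₀ hγ₀.ne']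
      abel
    rw [e, inner_neg_left, real_inner_smul_left, neg_nonpos] at h
    exact nonneg_of_mul_nonneg_right h hγ₀

end StandingAssumptions

end GNEGame

end

theorem theorem1 {N : ℕ} {m : Fin N → ℕ} {q : ℕ} (G : GNEGame N m q) (ℓ μ : ℝ)
    (hG : G.StandingAssumptions ℓ μ) :
    ∃ uStar : JointVec m,
      (G.IsVariationalGNE uStar ∧ ∀ v : JointVec m, G.IsVariationalGNE v → v = uStar) ∧
      ∃ γmax : ℝ, 0 < γmax ∧
        ∀ (γ : Fin N → ℝ) (γ₀ : ℝ),
          (∀ i, 0 < γ i ∧ γ i ≤ γmax) → 0 < γ₀ → γ₀ ≤ γmax →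
          ∀ (u : ℝ → JointVec m) (l : ℝ → EucVec q), G.IsSolution γ γ₀ u l →
            ∃ lStar ∈ nonnegOrthant q,
              Tendsto (fun t => (u t, l t)) atTop (𝓝 (uStar, lStar)) := by
  obtain ⟨uStar, hStar, huniq⟩ := hG.existsUnique_isVariationalGNE
  refine ⟨uStar, ⟨hStar, huniq⟩, ?_⟩
  have hμ := hG.μ_pos
  -- The threshold of `lyapunov_le` with L = √N ℓ; step sizes at most 1/κ make every inverse step at
  -- least κ.
  set κ : ℝ := ‖G.couplingMap‖ + (√N * ℓ) ^ 2 / (4 * μ) + 1 with hκ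
  have hκpos : 0 < κ := by positivity
  refine ⟨κ⁻¹, inv_pos.2 hκpos, fun γ γ₀ hγ hγ₀ hγ₀' u l hsol => ?_⟩
  obtain ⟨l₀, hl₀⟩ := exists_isKKTPair hG.convex_localSet (F := G.pseudoGrad)
    (A := G.couplingMap) hG.slater hStar.1.1.1 hStar.1.1.2
    fun v hv hAv => hStar.2 v ⟨hv, hAv⟩
  -- Velocities at negative times are set to 0, so that `choose` yields functions on all of ℝ.
  have hsol' : ∀ t, ∃ (du : JointVec m) (dl : EucVec q), 0 ≤ t →
      HasDerivWithinAt u du (Set.Ici 0) t ∧ HasDerivWithinAt l dl (Set.Ici 0) t ∧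
      IsPrimalDualStep G.localSet (nonnegOrthant q) G.pseudoGrad G.couplingMap G.b
        (blockScale fun i => (γ i)⁻¹) γ₀ (u t) (l t) du dl := by
    intro t
    by_cases ht : 0 ≤ t
    · obtain ⟨du, dl, hu, hl, hdu, hdl⟩ := hsol t ht
      exact ⟨du, dl, fun _ => ⟨hu, hl, hG.isPrimalDualStep (fun i => (hγ i).1) hγ₀ hdu hdl⟩⟩
    · exact ⟨0, 0, fun h => absurd h ht⟩
  choose du dl hd using hsol'
  obtain ⟨p, hp, hlim⟩ := exists_isKKTPair_tendsto hG.isClosed_localSet isClosed_nonnegOrthant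
    hμ hG.norm_pseudoGrad_sub_le hG.strongly_monotone (inner_blockScale_left _) hκ.ge
    (le_inner_blockScale_self fun i => (le_inv_comm₀ hκpos (hγ i).1).2 (hγ i).2)
    ((le_inv_comm₀ hκpos hγ₀).2 hγ₀') (p₀ := (uStar, l₀)) hl₀
    (fun t ht => (hd t ht).1) (fun t ht => (hd t ht).2.1) (fun t ht => (hd t ht).2.2)
  obtain ⟨hAp, hvi⟩ := hp.variationalInequality
  have hpu : p.1 = uStar := huniq _
    (hG.isVariationalGNE ⟨hp.mem_left, hAp⟩ fun v hv => hvi v hv.1 hv.2)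
  exact ⟨p.2, hp.mem_right, hpu ▸ hlim⟩
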